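/- Consider the two-stage General Lotto game with pre-allocations on $n$ battlefields with values $w_1,\dots,w_n>0$, $\sum_b w_b=1$. In Stage 1, player $A$ chooses $\boldsymbol p\in\Delta_n(P)=\{\boldsymbol p\in\mathbb R_{\ge 0}^n:\sum_b p_b=P\}$, which both players observe. In Stage 2, each player $i\in\{A,B\}$ simultaneously chooses a probability distribution $F_i$ on $\mathbb R_{\ge0}^n$ with $\mathbb E_{x_i\sim F_i}[\sum_b x_{i,b}]\le R_i$. The payoff of $A$ is $U_A=\mathbb E[\sum_b w_b s_b]$ with $x_A\sim F_A$ and $x_B\sim F_B$ independent, where $s_b=1$ if $x_{A,b}+p_b>x_{B,b}$, $s_b=0$ if $x_{A,b}+p_b<x_{B,b}$, and at a tie $s_b=\tau_b$ for a fixed tie-breaking rule $\tau\in[0,1]^n$; the payoff of $B$ is $U_B=1-U_A$. A subgame-perfect equilibrium (SPE) consists of $\boldsymbol p^*\in\Delta_n(P)$ and, for every $\boldsymbol p\in\Delta_n(P)$, a Nash equilibrium $(F_A^*(\boldsymbol p),F_B^*(\boldsymbol p))$ of Stage 2 after $\boldsymbol p$, such that $\boldsymbol p^*$ maximizes $U_A(\boldsymbol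 p,F_A^*(\boldsymbol p),F_B^*(\boldsymbol p))$ over $\Delta_n(P)$. Fix $R_B>0$ and $\Pi\in[0,1]$. 1. If ties are won by $B$ ($\tau=0$), then for all $P,R_A\ge0$ an SPE exists and all SPEs give $A$ the same payoff, denoted $\pi_A^*(P,R_A,R_B)$. 2. Let $L_\Pi=\{(P,R_A)\in\mathbb R_{\ge0}^2:\pi_A^*(P,R_A,R_B)=\Pi\}$. If $\Pi<1$, then $$L_\Pi=\Big\{(P,R_\Pi(P)):P\in\Big[0,\tfrac{R_B}{1-\Pi}\Big]\Big\},$$ where, for $0\le\Pi<\tfrac12$, $$R_\Pi(P)=\begin{cases}2\Pi(R_B-P),&0\le P<\frac{(1-2\Pi)R_B}{1-\Pi},\\[2pt] \frac{(R_B-(1-\Pi)P)^2}{2R_B(1-\Pi)},&\frac{(1-2\Pi)R_B}{1-\Pi}\le P\le\frac{R_B}{1-\Pi},\end{cases}$$ and, for $\tfrac12\le\Pi<1$, $R_\Pi(P)=\frac{(R_B-(1-\Pi)P)^2}{2R_B(1-\Pi)}$ for all $P\in[0,\frac{R_B}{1-\Pi}]$. If $P>\frac{R_B}{1-\Pi}$,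 then $\pi_A^*(P,R_A,R_B)>\Pi$ for every $R_A\ge0$. If $\Pi=1$, then $L_\Pi=\emptyset$. 3. The tie-breaking rule is immaterial: for every $\tau\in[0,1]^n$ and all $P,R_A\ge0$, an SPE exists whenever $R_A>0$ or $P<R_B$, and whenever an SPE exists, $A$'s payoff in it is the same number $\pi_A^*(P,R_A,R_B)$. -/

import Mathlib

open MeasureTheory

/-- The strategies of a player with real-time budget `R`: probability distributions over
nonnegative allocations to the `n` battlefields whose expected total expenditure is at most `R`. -/
def lottoStrategies (n : ℕ) (R : ℝ) : Set (Measure (Fin n → ℝ)) :=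
  {F | IsProbabilityMeasure F ∧ (∀ᵐ x ∂F, ∀ b, 0 ≤ x b) ∧
    ∫⁻ x, ∑ b, ENNReal.ofReal (x b) ∂F ≤ ENNReal.ofReal R}

/-- The feasible pre-allocation profiles: nonnegative vectors with total `P`. -/
def preallocations (n : ℕ) (P : ℝ) : Set (Fin n → ℝ) :=
  {p | (∀ b, 0 ≤ p b) ∧ ∑ b, p b = P}

/-- The fraction of a battlefield won by player `A` when `A` has the total `a` on it and `B` has
the amount `c`; `t` is the fraction that `A` receives at a tie. -/
noncomputable def winShare (t a c : ℝ) : ℝ :=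
  if c < a then 1 else if a = c then t else 0

/-- The expected payoff of player `A` in the final stage, for independent strategies `FA`, `FB`.
The tie-breaking rule `τ` gives the fraction `τ b` of battlefield `b` to player `A` at a tie;
`τ = 1` is the indicator of `x_{A,b} + p_b ≥ x_{B,b}`, `τ = 0` that of the strict inequality. -/
noncomputable def payoffA {n : ℕ} (τ w p : Fin n → ℝ) (FA FB : Measure (Fin n → ℝ)) : ℝ :=
  ∫ x, ∑ b, w b * winShare (τ b) (x.1 b + p b) (x.2 b) ∂(FA.prod FB)

/-- The expected payoff of player `B` (the battlefield values add up to one). -/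
noncomputable def payoffB {n : ℕ} (τ w p : Fin n → ℝ) (FA FB : Measure (Fin n → ℝ)) : ℝ :=
  1 - payoffA τ w p FA FB

/-- Nash equilibria of the final-stage subgame after the pre-allocation `p`. -/
def IsSubgameNash {n : ℕ} (τ w p : Fin n → ℝ) (RA RB : ℝ) (FA FB : Measure (Fin n → ℝ)) : Prop :=
  FA ∈ lottoStrategies n RA ∧ FB ∈ lottoStrategies n RB ∧
  (∀ F ∈ lottoStrategies n RA, payoffA τ w p F FB ≤ payoffA τ w p FA FB) ∧
  (∀ F ∈ lottoStrategies n RB, payoffB τ w p FA F ≤ payoffB τ w p FA FB)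

/-- Subgame-perfect equilibria `(p*, FA*(·), FB*(·))` of the two-stage game. -/
def IsSPE {n : ℕ} (τ w : Fin n → ℝ) (P RA RB : ℝ) (pstar : Fin n → ℝ)
    (FA FB : (Fin n → ℝ) → Measure (Fin n → ℝ)) : Prop :=
  pstar ∈ preallocations n P ∧
  (∀ p ∈ preallocations n P, IsSubgameNash τ w p RA RB (FA p) (FB p)) ∧
  (∀ p ∈ preallocations n P,
    payoffA τ w p (FA p) (FB p) ≤ payoffA τ w pstar (FA pstar) (FB pstar))

/-- `v` is the payoff of player `A` in a subgame-perfect equilibrium. -/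
def IsSPEPayoffA {n : ℕ} (τ w : Fin n → ℝ) (P RA RB v : ℝ) : Prop :=
  ∃ (pstar : Fin n → ℝ) (FA FB : (Fin n → ℝ) → Measure (Fin n → ℝ)),
    IsSPE τ w P RA RB pstar FA FB ∧ payoffA τ w pstar (FA pstar) (FB pstar) = v

/-- The level curve of performance level `c`: the pairs `(P, R_A)` of nonnegative reals for which
the subgame-perfect equilibrium payoff of player `A` is `c`. -/
def levelCurve {n : ℕ} (τ w : Fin n → ℝ) (RB c : ℝ) : Set (ℝ × ℝ) :=
  {q | 0 ≤ q.1 ∧ 0 ≤ q.2 ∧ IsSPEPayoffA τ w q.1 q.2 RB c}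

/-- The function whose graph is the level curve of performance level `c < 1`. -/
noncomputable def levelFn (RB c P : ℝ) : ℝ :=
  if c < 1 / 2 ∧ P < (1 - 2 * c) * RB / (1 - c) then 2 * c * (RB - P)
  else (RB - (1 - c) * P) ^ 2 / (2 * RB * (1 - c))

/-! Each final stage is zero-sum, and since payoffs and budgets are sums over battlefields inside an
expectation, only marginals matter: one uniform variable can drive all bids. With `q b = p b / w b`,
let A bid uniformly on `[0, w b * x b]` with probability `x b / t`, and let B bid uniformly on `[p
b, p b + w b * x b]` with probability `x b / s`, both bidding zero otherwise. Against either
strategy, the opponent's gain is bounded by an affine function of expenditure, with slope `1/t` or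
`1/s` (`le_payoffA_rampStrategy`, `payoffA_rampStrategy_le`). The two guarantees coincide when `x b
= min s (max (t - q b) 0)` and both budgets bind; `exists_budget_multipliers` finds such `s` and `t`
by continuity.

In the first stage, B can use one constant `x` on all battlefields. The cost of this strategy
depends on `p` only through `∑ p b = P`, so B holds A to the same number after every pre-allocation,
while A secures that number after the proportional one. Hence the game has the value `(x + P - RB) /
t`, where `s`, `t`, `x` solve the equations for a single battlefield
(`IsProportionalSolution.isGameValue`). Eliminating them gives the two branches of `levelFn`: the
first when `x = s`, the second when `x + P = t`.

All guarantees count only strict wins and losses, so they hold for every tie-breaking rule. For `RA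
= 0` the multipliers degenerate; A can only bid zero, and B's near-optimal bids determine the value.
Ties then affect only whether an equilibrium exists. -/

/-! ### Payoffs and guarantees in the final stage -/

lemma winShare_mem_Icc {t : ℝ} (ht : t ∈ Set.Icc (0 : ℝ) 1) (a c : ℝ) :
    winShare t a c ∈ Set.Icc (0 : ℝ) 1 := by
  unfold winShare
  split_ifs
  · simp
  · exact ht
  · simp

lemma winShare_of_lt {t a c : ℝ} (h : c < a) : winShare t a c = 1 := by
  simp [winShare, h]

lemma winShare_of_gt {t a c : ℝ} (h : a < c) : winShare t a c = 0 := by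
  simp [winShare, h.not_gt, h.ne]

lemma measurable_winShare (t : ℝ) {α : Type*} [MeasurableSpace α] {f g : α → ℝ}
    (hf : Measurable f) (hg : Measurable g) : Measurable fun z => winShare t (f z) (g z) := by
  unfold winShare
  exact Measurable.ite (measurableSet_lt hg hf) measurable_const
    (Measurable.ite (measurableSet_eq_fun hf hg) measurable_const measurable_const)

/-- The total share won by player `A` in a pure strategy profile. -/
noncomputable def totalShare {n : ℕ} (τ w p x y : Fin n → ℝ) : ℝ :=
  ∑ b, w b * winShare (τ b) (x b + p b) (y b)

section totalShare

variable {n : ℕ} {τ w : Fin n → ℝ}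

lemma totalShare_nonneg (hw : ∀ b, 0 < w b) (hτ : ∀ b, τ b ∈ Set.Icc (0 : ℝ) 1)
    (p x y : Fin n → ℝ) : 0 ≤ totalShare τ w p x y :=
  Finset.sum_nonneg fun b _ => mul_nonneg (hw b).le (winShare_mem_Icc (hτ b) _ _).1

lemma totalShare_le_one (hw : ∀ b, 0 < w b) (hsum : ∑ b, w b = 1)
    (hτ : ∀ b, τ b ∈ Set.Icc (0 : ℝ) 1) (p x y : Fin n → ℝ) : totalShare τ w p x y ≤ 1 := by
  rw [← hsum]
  exact Finset.sum_le_sum fun b _ =>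
    mul_le_of_le_one_right (hw b).le (winShare_mem_Icc (hτ b) _ _).2

lemma measurable_totalShare (p : Fin n → ℝ) {α : Type*} [MeasurableSpace α]
    {f g : α → Fin n → ℝ} (hf : Measurable f) (hg : Measurable g) :
    Measurable fun z => totalShare τ w p (f z) (g z) := by
  unfold totalShare
  refine Finset.measurable_sum _ fun b _ => (measurable_winShare _ ?_ ?_).const_mul _
  · exact ((measurable_pi_apply b).comp hf).add_const _
  · exact (measurable_pi_apply b).comp hg

lemma integrable_totalShare (hw : ∀ b, 0 < w b) (hsum : ∑ b, w b = 1)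
    (hτ : ∀ b, τ b ∈ Set.Icc (0 : ℝ) 1) (p : Fin n → ℝ) {α : Type*} [MeasurableSpace α]
    (μ : Measure α) [IsFiniteMeasure μ]
    {f g : α → Fin n → ℝ} (hf : Measurable f) (hg : Measurable g) :
    Integrable (fun z => totalShare τ w p (f z) (g z)) μ :=
  Integrable.of_mem_Icc 0 1 (measurable_totalShare p hf hg).aemeasurable
    (Filter.Eventually.of_forall fun _ =>
      ⟨totalShare_nonneg hw hτ _ _ _, totalShare_le_one hw hsum hτ _ _ _⟩)

lemma payoffA_eq_integral (p : Fin n → ℝ) (FA FB : Measure (Fin n → ℝ)) :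
    payoffA τ w p FA FB = ∫ z, totalShare τ w p z.1 z.2 ∂(FA.prod FB) := rfl

lemma payoffA_nonneg (hw : ∀ b, 0 < w b) (hτ : ∀ b, τ b ∈ Set.Icc (0 : ℝ) 1)
    (p : Fin n → ℝ) (FA FB : Measure (Fin n → ℝ)) : 0 ≤ payoffA τ w p FA FB :=
  integral_nonneg fun _ => totalShare_nonneg hw hτ _ _ _

lemma integrable_sum_of_mem_lottoStrategies {R : ℝ} {F : Measure (Fin n → ℝ)}
    (hF : F ∈ lottoStrategies n R) : Integrable (fun x => ∑ b, x b) F := by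
  obtain ⟨_, h0, hR⟩ := hF
  refine ⟨by fun_prop, ?_⟩
  rw [hasFiniteIntegral_iff_ofReal]
  · refine lt_of_le_of_lt ?_ (hR.trans_lt ENNReal.ofReal_lt_top)
    refine lintegral_mono_ae ?_
    filter_upwards [h0] with x hx
    rw [ENNReal.ofReal_sum_of_nonneg fun b _ => hx b]
  · filter_upwards [h0] with x hx using Finset.sum_nonneg fun b _ => hx b

lemma integral_sum_le_of_mem_lottoStrategies {R : ℝ} (hR0 : 0 ≤ R) {F : Measure (Fin n → ℝ)}
    (hF : F ∈ lottoStrategies n R) : ∫ x, ∑ b, x b ∂F ≤ R := by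
  have hi := integrable_sum_of_mem_lottoStrategies hF
  obtain ⟨_, h0, hR⟩ := hF
  have h0' : 0 ≤ᵐ[F] fun x => ∑ b, x b := by
    filter_upwards [h0] with x hx using Finset.sum_nonneg fun b _ => hx b
  rw [integral_eq_lintegral_of_nonneg_ae h0' hi.1]
  refine ENNReal.toReal_le_of_le_ofReal hR0 (le_trans (lintegral_mono_ae ?_) hR)
  filter_upwards [h0] with x hx
  rw [ENNReal.ofReal_sum_of_nonneg fun b _ => hx b]

/-- Weak duality: `l` is a price on B's expenditure, so a bound against every pure reply integrates
to one that involves only the budget. `payoffA_le` is its mirror image. -/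
lemma le_payoffA (hw : ∀ b, 0 < w b) (hsum : ∑ b, w b = 1)
    (hτ : ∀ b, τ b ∈ Set.Icc (0 : ℝ) 1) {p : Fin n → ℝ} {R C l : ℝ} (hR : 0 ≤ R) (hl : 0 ≤ l)
    {FA FB : Measure (Fin n → ℝ)} [IsProbabilityMeasure FA] (hFB : FB ∈ lottoStrategies n R)
    (H : ∀ y : Fin n → ℝ, (∀ b, 0 ≤ y b) →
      C - l * ∑ b, y b ≤ ∫ x, totalShare τ w p x y ∂FA) :
    C - l * R ≤ payoffA τ w p FA FB := by
  have hi := integrable_sum_of_mem_lottoStrategies hFB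
  have hle := integral_sum_le_of_mem_lottoStrategies hR hFB
  obtain ⟨_, h0, -⟩ := hFB
  have hint := integrable_totalShare hw hsum hτ p (FA.prod FB) measurable_fst measurable_snd
  rw [payoffA_eq_integral, integral_prod_symm _ hint]
  calc C - l * R ≤ C - l * ∫ y, ∑ b, y b ∂FB := by gcongr
    _ = ∫ y, (C - l * ∑ b, y b) ∂FB := by
      rw [integral_sub (integrable_const _) (hi.const_mul _), integral_const_mul]; simp
    _ ≤ _ := by
      refine integral_mono_ae ((integrable_const _).sub (hi.const_mul _)) hint.integral_prod_right ?_
      filter_upwards [h0] with y hy using H y hy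

lemma payoffA_le (hw : ∀ b, 0 < w b) (hsum : ∑ b, w b = 1)
    (hτ : ∀ b, τ b ∈ Set.Icc (0 : ℝ) 1) {p : Fin n → ℝ} {R C l : ℝ} (hR : 0 ≤ R) (hl : 0 ≤ l)
    {FA FB : Measure (Fin n → ℝ)} [IsProbabilityMeasure FB] (hFA : FA ∈ lottoStrategies n R)
    (H : ∀ x : Fin n → ℝ, (∀ b, 0 ≤ x b) →
      ∫ y, totalShare τ w p x y ∂FB ≤ C + l * ∑ b, x b) :
    payoffA τ w p FA FB ≤ C + l * R := by
  have hi := integrable_sum_of_mem_lottoStrategies hFA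
  have hle := integral_sum_le_of_mem_lottoStrategies hR hFA
  obtain ⟨_, h0, -⟩ := hFA
  have hint := integrable_totalShare hw hsum hτ p (FA.prod FB) measurable_fst measurable_snd
  rw [payoffA_eq_integral, integral_prod _ hint]
  calc _ ≤ ∫ x, (C + l * ∑ b, x b) ∂FA := by
        refine integral_mono_ae hint.integral_prod_left
          ((integrable_const _).add (hi.const_mul _)) ?_
        filter_upwards [h0] with x hx using H x hx
    _ = C + l * ∫ x, ∑ b, x b ∂FA := by
      rw [integral_add (integrable_const _) (hi.const_mul _), integral_const_mul]; simp
    _ ≤ C + l * R := by gcongr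

/-- Two strategies that guarantee the same `v` form a saddle point. -/
lemma isSubgameNash_of_guarantees {p : Fin n → ℝ} {RA RB v : ℝ} {FA FB : Measure (Fin n → ℝ)}
    (hA : FA ∈ lottoStrategies n RA) (hB : FB ∈ lottoStrategies n RB)
    (h1 : ∀ F ∈ lottoStrategies n RB, v ≤ payoffA τ w p FA F)
    (h2 : ∀ F ∈ lottoStrategies n RA, payoffA τ w p F FB ≤ v) :
    IsSubgameNash τ w p RA RB FA FB :=
  ⟨hA, hB, fun F hF => (h2 F hF).trans (h1 FB hB),
    fun F hF => sub_le_sub_left ((h2 FA hA).trans (h1 F hF)) 1⟩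

/-- A guarantee of B caps A's payoff in any equilibrium, because B could deviate to it. This and its
counterpart for A determine payoffs without classifying equilibria. -/
lemma IsSubgameNash.payoffA_le {p : Fin n → ℝ} {RA RB v : ℝ} {FA FB G : Measure (Fin n → ℝ)}
    (h : IsSubgameNash τ w p RA RB FA FB) (hG : G ∈ lottoStrategies n RB)
    (hv : ∀ F ∈ lottoStrategies n RA, payoffA τ w p F G ≤ v) : payoffA τ w p FA FB ≤ v := by
  obtain ⟨hA, -, -, h4⟩ := h
  have := h4 G hG
  have := hv FA hA
  unfold payoffB at *
  linarith

lemma IsSubgameNash.le_payoffA {p : Fin n → ℝ} {RA RB v : ℝ} {FA FB G : Measure (Fin n → ℝ)}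
    (h : IsSubgameNash τ w p RA RB FA FB) (hG : G ∈ lottoStrategies n RA)
    (hv : ∀ F ∈ lottoStrategies n RB, v ≤ payoffA τ w p G F) : v ≤ payoffA τ w p FA FB :=
  (hv FB h.2.1).trans (h.2.2.1 G hG)

end totalShare

/-! ### Bids driven by one uniform variable -/

/-- The uniform distribution on the unit interval. -/
noncomputable def unitUniform : Measure ℝ := volume.restrict (Set.Ioc 0 1)

instance : IsProbabilityMeasure unitUniform := ⟨by simp [unitUniform]⟩

/-- The allocation that puts `c b + d b * u` on battlefield `b` if `u ≤ k b`, and nothing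
otherwise. -/
noncomputable def rampAllocation {n : ℕ} (k c d : Fin n → ℝ) (u : ℝ) (b : Fin n) : ℝ :=
  if u ≤ k b then c b + d b * u else 0

/-- The mixed strategy that plays `rampAllocation k c d u` for a uniform `u`. -/
noncomputable def rampStrategy {n : ℕ} (k c d : Fin n → ℝ) : Measure (Fin n → ℝ) :=
  unitUniform.map (rampAllocation k c d)

section ramp

variable {n : ℕ} {k c d : Fin n → ℝ}

lemma measurable_rampAllocation : Measurable (rampAllocation k c d) := by
  refine measurable_pi_lambda _ fun b => ?_
  exact Measurable.ite measurableSet_Iic (by fun_prop) measurable_const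

instance : IsProbabilityMeasure (rampStrategy k c d) :=
  Measure.isProbabilityMeasure_map measurable_rampAllocation.aemeasurable

lemma lintegral_ramp {k c d : ℝ} (hk : k ∈ Set.Icc (0 : ℝ) 1)
    (h : ∀ u, 0 ≤ u → u ≤ k → 0 ≤ c + d * u) :
    ∫⁻ u, ENNReal.ofReal (if u ≤ k then c + d * u else 0) ∂unitUniform =
      ENNReal.ofReal (c * k + d * k ^ 2 / 2) := by
  have e1 : (fun u : ℝ => ENNReal.ofReal (if u ≤ k then c + d * u else 0)) =
      (Set.Iic k).indicator fun u => ENNReal.ofReal (c + d * u) := by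
    ext u
    by_cases hu : u ≤ k <;> simp [hu]
  have e2 : Set.Iic k ∩ Set.Ioc 0 1 = Set.Ioc 0 k := by
    ext u
    simp only [Set.mem_inter_iff, Set.mem_Iic, Set.mem_Ioc]
    exact ⟨fun h => ⟨h.2.1, h.1⟩, fun h => ⟨h.2, h.1, h.2.trans hk.2⟩⟩
  rw [e1, lintegral_indicator measurableSet_Iic, unitUniform,
    Measure.restrict_restrict measurableSet_Iic, e2, ← ofReal_integral_eq_lintegral_ofReal]
  · rw [← intervalIntegral.integral_of_le hk.1]
    rw [intervalIntegral.integral_add (by simp)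
      ((by fun_prop : Continuous fun u : ℝ => d * u).intervalIntegrable _ _),
      intervalIntegral.integral_const_mul, intervalIntegral.integral_const, integral_id]
    congr 1
    simp only [smul_eq_mul]
    ring
  · exact ((continuous_const.add (continuous_const.mul continuous_id)).integrableOn_Icc).mono_set
      Set.Ioc_subset_Icc_self
  · exact (ae_restrict_mem measurableSet_Ioc).mono fun u hu => h u hu.1.le hu.2

lemma rampStrategy_mem_lottoStrategies {R : ℝ} (hk : ∀ b, k b ∈ Set.Icc (0 : ℝ) 1)
    (h : ∀ b u, 0 ≤ u → u ≤ k b → 0 ≤ c b + d b * u)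
    (hR : ∑ b, (c b * k b + d b * k b ^ 2 / 2) ≤ R) :
    rampStrategy k c d ∈ lottoStrategies n R := by
  have hm := measurable_rampAllocation (k := k) (c := c) (d := d)
  refine ⟨inferInstance, ?_, ?_⟩
  · have hs : MeasurableSet {x : Fin n → ℝ | ∀ b, 0 ≤ x b} := by
      rw [Set.ofPred_forall]
      exact MeasurableSet.iInter fun b => measurableSet_le measurable_const (measurable_pi_apply b)
    rw [rampStrategy, ae_map_iff hm.aemeasurable hs]
    refine (ae_restrict_mem measurableSet_Ioc).mono fun u hu b => ?_
    unfold rampAllocation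
    split_ifs with hub
    · exact h b u hu.1.le hub
    · exact le_rfl
  · rw [rampStrategy, lintegral_map (by fun_prop) hm, lintegral_finsetSum _ fun b _ => by
      exact ((measurable_pi_apply b).comp hm).ennreal_ofReal]
    have : ∀ b, ∫⁻ u, ENNReal.ofReal (rampAllocation k c d u b) ∂unitUniform =
        ENNReal.ofReal (c b * k b + d b * k b ^ 2 / 2) := fun b => lintegral_ramp (hk b) (h b)
    simp_rw [this]
    rw [← ENNReal.ofReal_sum_of_nonneg]
    · exact ENNReal.ofReal_le_ofReal hR
    · intro b _
      have h0 := h b 0 le_rfl (hk b).1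
      have h1 := h b (k b) (hk b).1 le_rfl
      -- The integral is the area of a trapezoid: `k b` times the mean of the two end values.
      nlinarith [mul_nonneg (hk b).1 (add_nonneg h0 h1)]

lemma integral_unitUniform_le {g : ℝ → ℝ} (hg : Measurable g) (h01 : ∀ u, g u ∈ Set.Icc (0 : ℝ) 1)
    {lo hi : ℝ} (hlo : 0 ≤ lo) (hhi : hi ≤ 1) (h : ∀ u, lo < u → u < hi → g u = 0) :
    ∫ u, g u ∂unitUniform ≤ 1 - (hi - lo) := by
  have hgi : Integrable g unitUniform :=
    Integrable.of_mem_Icc 0 1 hg.aemeasurable (Filter.Eventually.of_forall h01)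
  rcases le_total hi lo with hle | hle
  · calc ∫ u, g u ∂unitUniform ≤ ∫ _, 1 ∂unitUniform :=
          integral_mono hgi (integrable_const _) fun u => (h01 u).2
      _ ≤ _ := by simp; linarith
  · have hind : Integrable ((Set.Ioo lo hi).indicator fun _ => (1 : ℝ)) unitUniform :=
      (integrable_const _).indicator measurableSet_Ioo
    have hss : Set.Ioo lo hi ∩ Set.Ioc 0 1 = Set.Ioo lo hi :=
      Set.inter_eq_left.2 fun u hu => ⟨hlo.trans_lt hu.1, hu.2.le.trans hhi⟩
    calc ∫ u, g u ∂unitUniform ≤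
          ∫ u, (1 - (Set.Ioo lo hi).indicator (fun _ => (1 : ℝ)) u) ∂unitUniform := by
          refine integral_mono hgi ((integrable_const _).sub hind) fun u => ?_
          by_cases hu : u ∈ Set.Ioo lo hi
          · simp [hu, h u hu.1 hu.2]
          · simpa [hu] using (h01 u).2
      _ = 1 - (hi - lo) := by
          rw [integral_sub (integrable_const _) hind, integral_indicator measurableSet_Ioo,
            unitUniform, Measure.restrict_restrict measurableSet_Ioo, hss]
          simp [hle]

lemma le_integral_unitUniform {g : ℝ → ℝ} (hg : Measurable g) (h01 : ∀ u, g u ∈ Set.Icc (0 : ℝ) 1)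
    {hi : ℝ} (hhi : hi ≤ 1) (h : ∀ u, u < hi → g u = 1) :
    hi ≤ ∫ u, g u ∂unitUniform := by
  have hgi : Integrable g unitUniform :=
    Integrable.of_mem_Icc 0 1 hg.aemeasurable (Filter.Eventually.of_forall h01)
  have := integral_unitUniform_le (g := fun u => 1 - g u) (measurable_const.sub hg)
    (fun u => ⟨sub_nonneg.2 (h01 u).2, sub_le_self _ (h01 u).1⟩) le_rfl hhi
    (fun u _ hu => by rw [h u hu, sub_self])
  rw [integral_sub (integrable_const _) hgi] at this
  simp at this
  linarith

variable {τ w p : Fin n → ℝ}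

lemma integrable_winShare (hτ : ∀ b, τ b ∈ Set.Icc (0 : ℝ) 1) {f g : ℝ → ℝ}
    (hf : Measurable f) (hg : Measurable g) (b : Fin n) :
    Integrable (fun u => winShare (τ b) (f u) (g u)) unitUniform :=
  Integrable.of_mem_Icc 0 1 (measurable_winShare _ hf hg).aemeasurable
    (Filter.Eventually.of_forall fun _ => winShare_mem_Icc (hτ b) _ _)

lemma measurable_rampAllocation_apply (b : Fin n) :
    Measurable fun u => rampAllocation k c d u b :=
  (measurable_pi_apply b).comp measurable_rampAllocation

lemma integral_totalShare_rampStrategy_left (hτ : ∀ b, τ b ∈ Set.Icc (0 : ℝ) 1)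
    (y : Fin n → ℝ) :
    ∫ x, totalShare τ w p x y ∂rampStrategy k c d =
      ∑ b, w b * ∫ u, winShare (τ b) (rampAllocation k c d u b + p b) (y b) ∂unitUniform := by
  have hm : Measurable fun x => totalShare τ w p x y :=
    measurable_totalShare p measurable_id measurable_const
  rw [rampStrategy, integral_map measurable_rampAllocation.aemeasurable hm.aestronglyMeasurable]
  unfold totalShare
  rw [integral_finsetSum _ fun b _ => (integrable_winShare hτ
    ((measurable_rampAllocation_apply b).add_const _) measurable_const b).const_mul _]
  simp_rw [integral_const_mul]

lemma integral_totalShare_rampStrategy_right (hτ : ∀ b, τ b ∈ Set.Icc (0 : ℝ) 1)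
    (x : Fin n → ℝ) :
    ∫ y, totalShare τ w p x y ∂rampStrategy k c d =
      ∑ b, w b * ∫ u, winShare (τ b) (x b + p b) (rampAllocation k c d u b) ∂unitUniform := by
  have hm : Measurable fun y => totalShare τ w p x y :=
    measurable_totalShare p measurable_const measurable_id
  rw [rampStrategy, integral_map measurable_rampAllocation.aemeasurable hm.aestronglyMeasurable]
  unfold totalShare
  rw [integral_finsetSum _ fun b _ => (integrable_winShare hτ measurable_const
    (measurable_rampAllocation_apply b) b).const_mul _]
  simp_rw [integral_const_mul]

/-- The payoff that `A` secures by spreading uniformly over an interval that starts at zero. -/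
lemma le_payoffA_rampStrategy (hw : ∀ b, 0 < w b) (hsum : ∑ b, w b = 1)
    (hτ : ∀ b, τ b ∈ Set.Icc (0 : ℝ) 1) {RB t : ℝ} (hRB : 0 ≤ RB) (ht : 0 < t) (x : Fin n → ℝ)
    {F : Measure (Fin n → ℝ)} (hF : F ∈ lottoStrategies n RB) :
    ∑ b, w b * min 1 ((x b + p b / w b) / t) - t⁻¹ * RB ≤
      payoffA τ w p (rampStrategy (fun b => x b / t) (fun b => w b * x b) (fun b => -(w b * t)))
        F := by
  refine le_payoffA hw hsum hτ hRB (inv_nonneg.2 ht.le) hF fun y hy => ?_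
  rw [integral_totalShare_rampStrategy_left hτ, Finset.mul_sum, ← Finset.sum_sub_distrib]
  refine Finset.sum_le_sum fun b _ => ?_
  have hwb := hw b
  have e : w b * min 1 ((x b + p b / w b) / t) - t⁻¹ * y b =
      w b * (min 1 ((x b + p b / w b) / t) - y b / (w b * t)) := by
    field_simp
  rw [e]
  refine mul_le_mul_of_nonneg_left (le_integral_unitUniform (measurable_winShare _
    ((measurable_rampAllocation_apply b).add_const _) measurable_const)
    (fun u => winShare_mem_Icc (hτ b) _ _) ?_ fun u hu => winShare_of_lt ?_) hwb.le
  · have : 0 ≤ y b / (w b * t) := div_nonneg (hy b) (by positivity)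
    linarith [min_le_left 1 ((x b + p b / w b) / t)]
  · have h1 : u < (x b + p b / w b) / t - y b / (w b * t) :=
      hu.trans_le (sub_le_sub_right (min_le_right _ _) _)
    have h2 : (x b + p b / w b) / t - y b / (w b * t) = (w b * x b + p b - y b) / (w b * t) := by
      field_simp
    rw [h2, lt_div_iff₀ (by positivity)] at h1
    -- Beyond `u = x b / t` the linear expression is negative and the actual bid is zero, so the
    -- linear bid is a lower bound everywhere.
    have h3 : w b * x b + -(w b * t) * u ≤ rampAllocation (fun b => x b / t)
        (fun b => w b * x b) (fun b => -(w b * t)) u b := by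
      unfold rampAllocation
      split_ifs with h
      · exact le_rfl
      · rw [not_le, div_lt_iff₀ ht] at h
        nlinarith
    nlinarith

/-- The payoff to which `B` can hold `A` by topping the pre-allocation by a uniform amount with
some probability. -/
lemma payoffA_rampStrategy_le (hw : ∀ b, 0 < w b) (hsum : ∑ b, w b = 1)
    (hτ : ∀ b, τ b ∈ Set.Icc (0 : ℝ) 1) {RA s : ℝ} (hRA : 0 ≤ RA) (hs : 0 < s) {x : Fin n → ℝ}
    (hxs : ∀ b, x b ≤ s) {F : Measure (Fin n → ℝ)} (hF : F ∈ lottoStrategies n RA) :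
    payoffA τ w p F (rampStrategy (fun b => x b / s) p (fun b => w b * s)) ≤
      ∑ b, w b * (1 - x b / s) + s⁻¹ * RA := by
  refine payoffA_le hw hsum hτ hRA (inv_nonneg.2 hs.le) hF fun z hz => ?_
  rw [integral_totalShare_rampStrategy_right hτ, Finset.mul_sum, ← Finset.sum_add_distrib]
  refine Finset.sum_le_sum fun b _ => ?_
  have hwb := hw b
  have e : w b * (1 - x b / s) + s⁻¹ * z b = w b * (1 - (x b / s - z b / (w b * s))) := by
    field_simp
    ring
  rw [e]
  refine mul_le_mul_of_nonneg_left (integral_unitUniform_le (measurable_winShare _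
    measurable_const (measurable_rampAllocation_apply b))
    (fun u => winShare_mem_Icc (hτ b) _ _) (div_nonneg (hz b) (by positivity))
    ((div_le_one hs).2 (hxs b)) fun u h1 h2 => winShare_of_gt ?_) hwb.le
  rw [div_lt_iff₀ (by positivity)] at h1
  simp only [rampAllocation, h2.le, if_true]
  linarith

end ramp

/-! ### Existence of the budget multipliers -/

/-- `F r` crosses the level `R` at `T r`. A strict inequality at a fixed `t` on either side of `T r`
survives small changes of `r`, which traps `T r'` near `T r`. -/
lemma continuousOn_of_implicit {F : ℝ → ℝ → ℝ} {T : ℝ → ℝ} {R : ℝ}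
    (hT : ∀ r, 0 < r → 0 < T r) (hF : ∀ t, Continuous fun r => F r t)
    (hlt : ∀ r t, 0 < r → 0 < t → t < T r → F r t < R)
    (hgt : ∀ r t, 0 < r → T r < t → R < F r t) : ContinuousOn T (Set.Ioi 0) := by
  intro r hr
  have hev : ∀ᶠ r' in nhdsWithin r (Set.Ioi 0), 0 < r' := eventually_mem_nhdsWithin
  have hcont : ∀ t, Filter.Tendsto (fun r => F r t) (nhdsWithin r (Set.Ioi 0)) (nhds (F r t)) :=
    fun t => ((hF t).tendsto r).mono_left nhdsWithin_le_nhds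
  refine tendsto_order.2 ⟨fun a ha => ?_, fun a ha => ?_⟩
  · obtain ⟨t, ht1, ht2⟩ := exists_between (max_lt ha (hT r hr))
    have h := hlt r t hr ((le_max_right _ _).trans_lt ht1) ht2
    filter_upwards [(hcont t).eventually_lt_const h, hev] with r' h1 h2
    by_contra! h3
    exact (hgt r' t h2 (h3.trans_lt ((le_max_left _ _).trans_lt ht1))).not_gt h1
  · obtain ⟨t, ht1, ht2⟩ := exists_between ha
    have h := hgt r t hr ht1
    filter_upwards [(hcont t).eventually_const_lt h, hev] with r' h1 h2
    by_contra! h3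
    exact (hlt r' t h2 ((hT r hr).trans ht1) (ht2.trans_le h3)).not_gt h1

/-- The multipliers of the two budget constraints in the equilibrium of the final stage. -/
theorem exists_budget_multipliers {n : ℕ} {w q : Fin n → ℝ} (hw : ∀ b, 0 < w b)
    (hsum : ∑ b, w b = 1) (hq : ∀ b, 0 ≤ q b) {RA RB : ℝ} (hRA : 0 < RA) (hRB : 0 < RB) :
    ∃ (s t : ℝ) (x : Fin n → ℝ), 0 < s ∧ 0 < t ∧ (∀ b, x b = min s (max (t - q b) 0)) ∧
      ∑ b, w b * x b ^ 2 = 2 * t * RA ∧ ∑ b, w b * (x b * (q b + x b / 2)) = s * RB := by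
  -- Rescaled unknowns: `r = s / t` and `ξ = x / t`. For fixed `r`, A's budget equation becomes `t *
  -- G r t = 2 * RA`, with left side increasing in `t` where it is positive; B's equation then fixes
  -- `r`.
  set ξ : ℝ → ℝ → Fin n → ℝ := fun r t b => min r (max (1 - q b / t) 0) with hξ
  have ξ0 : ∀ r t b, 0 < r → 0 ≤ ξ r t b := fun r t b hr => le_min hr.le (le_max_right _ _)
  have ξr : ∀ r t b, ξ r t b ≤ r := fun r t b => min_le_left _ _
  have ξmono : ∀ r t t' b, 0 < t → t ≤ t' → ξ r t b ≤ ξ r t' b := by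
    intro r t t' b ht htt
    have := hq b
    simp only [hξ]
    gcongr
  set G : ℝ → ℝ → ℝ := fun r t => ∑ b, w b * ξ r t b ^ 2 with hG
  have G0 : ∀ r t, 0 ≤ G r t := fun r t =>
    Finset.sum_nonneg fun b _ => mul_nonneg (hw b).le (sq_nonneg _)
  have Gmono : ∀ r t t', 0 < r → 0 < t → t ≤ t' → G r t ≤ G r t' := by
    intro r t t' hr ht htt
    refine Finset.sum_le_sum fun b _ => mul_le_mul_of_nonneg_left ?_ (hw b).le
    exact pow_le_pow_left₀ (ξ0 r t b hr) (ξmono r t t' b ht htt) 2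
  have Gr : ∀ r t, 0 < r → G r t ≤ r ^ 2 := by
    intro r t hr
    calc G r t ≤ ∑ b, w b * r ^ 2 := Finset.sum_le_sum fun b _ =>
          mul_le_mul_of_nonneg_left (pow_le_pow_left₀ (ξ0 r t b hr) (ξr r t b) 2) (hw b).le
      _ = r ^ 2 := by rw [← Finset.sum_mul, hsum, one_mul]
  have hex : ∀ r, 0 < r → ∃ t, 0 < t ∧ t * G r t = 2 * RA := by
    intro r hr
    -- At `t1` every `q b / t1` is at most `1/2`, so `ξ ≥ m` and `G ≥ m ^ 2`; at `t0` the bound `G ≤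
    -- r ^ 2` suffices. These bracket the root.
    set m := min r (1 / 2) with hm
    have hm0 : 0 < m := lt_min hr (by norm_num)
    set Q := ∑ b, q b with hQ
    have hQ0 : 0 ≤ Q := Finset.sum_nonneg fun b _ => hq b
    have hqQ : ∀ b, q b ≤ Q := fun b =>
      Finset.single_le_sum (fun b _ => hq b) (Finset.mem_univ b)
    set t1 := 2 * Q + 2 * RA / m ^ 2 with ht1
    set t0 := min t1 (2 * RA / r ^ 2) with ht0
    have ht1pos : 0 < t1 := by positivity
    have ht0pos : 0 < t0 := lt_min ht1pos (by positivity)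
    have hc : ContinuousOn (fun t => t * G r t) (Set.Icc t0 t1) := by
      simp only [hG, hξ]
      have : ∀ t ∈ Set.Icc t0 t1, t ≠ 0 := fun t ht => (ht0pos.trans_le ht.1).ne'
      refine continuousOn_id.mul (continuousOn_finsetSum _ fun b _ => continuousOn_const.mul
        (ContinuousOn.pow (continuousOn_const.inf (ContinuousOn.sup (continuousOn_const.sub
          (continuousOn_const.div continuousOn_id this)) continuousOn_const)) 2))
    have h0 : t0 * G r t0 ≤ 2 * RA := by
      calc t0 * G r t0 ≤ (2 * RA / r ^ 2) * r ^ 2 := by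
            gcongr
            · exact G0 _ _
            · exact min_le_right _ _
            · exact Gr r t0 hr
        _ = 2 * RA := by field_simp
    have h1 : 2 * RA ≤ t1 * G r t1 := by
      have hGm : m ^ 2 ≤ G r t1 := by
        calc m ^ 2 = ∑ b, w b * m ^ 2 := by rw [← Finset.sum_mul, hsum, one_mul]
          _ ≤ G r t1 := by
            refine Finset.sum_le_sum fun b _ => mul_le_mul_of_nonneg_left
              (pow_le_pow_left₀ hm0.le (le_min (min_le_left _ _) ?_) 2) (hw b).le
            refine (min_le_right _ _).trans (le_trans ?_ (le_max_left _ _))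
            have : q b / t1 ≤ 1 / 2 := by
              rw [div_le_iff₀ ht1pos]
              have : 0 < 2 * RA / m ^ 2 := by positivity
              linarith [hqQ b]
            linarith
      calc 2 * RA = (2 * RA / m ^ 2) * m ^ 2 := by field_simp
        _ ≤ t1 * G r t1 := by
          gcongr
          linarith
    obtain ⟨t, ht, hte⟩ := intermediate_value_Icc (min_le_left _ _) hc ⟨h0, h1⟩
    exact ⟨t, ht0pos.trans_le ht.1, hte⟩
  choose! T hTpos hTe using hex
  have hgt : ∀ r t, 0 < r → T r < t → 2 * RA < t * G r t := by
    intro r t hr ht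
    have h1 := hTpos r hr
    have h2 := hTe r hr
    have h3 : 0 < G r (T r) := by
      by_contra! h
      nlinarith
    have h4 := Gmono r _ _ hr h1 ht.le
    nlinarith
  have hlt : ∀ r t, 0 < r → 0 < t → t < T r → t * G r t < 2 * RA := by
    intro r t hr ht htT
    by_contra! h
    have h2 := hTe r hr
    have h3 : 0 < G r t := by
      by_contra! h'
      nlinarith
    have h4 := Gmono r _ _ hr ht htT.le
    nlinarith
  have hTcont : ContinuousOn T (Set.Ioi 0) := by
    refine continuousOn_of_implicit (F := fun r t => t * G r t) hTpos (fun t => ?_) hlt hgt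
    simp only [hG, hξ]
    fun_prop
  set E : ℝ → ℝ := fun r => (∑ b, w b * (ξ r (T r) b * (q b + T r * ξ r (T r) b / 2))) / r with hE
  have hEcont : ContinuousOn E (Set.Ioi 0) := by
    have hξc : ∀ b, ContinuousOn (fun r => ξ r (T r) b) (Set.Ioi 0) := fun b =>
      continuousOn_id.inf (ContinuousOn.sup (continuousOn_const.sub
        (continuousOn_const.div hTcont fun r hr => (hTpos r hr).ne')) continuousOn_const)
    refine ContinuousOn.div (continuousOn_finsetSum _ fun b _ => continuousOn_const.mul
      ((hξc b).mul (continuousOn_const.add ((hTcont.mul (hξc b)).div_const 2))))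
      continuousOn_id fun r hr => ne_of_gt hr
  have hElow : ∀ r, 0 < r → RA / r ≤ E r := by
    intro r hr
    simp only [hE]
    gcongr
    have h2 := hTe r hr
    have : RA = ∑ b, w b * (ξ r (T r) b * (T r * ξ r (T r) b / 2)) := by
      rw [hG, Finset.mul_sum] at h2
      have : RA = ∑ b, T r * (w b * ξ r (T r) b ^ 2) / 2 := by
        rw [← Finset.sum_div, h2]; ring
      rw [this]
      exact Finset.sum_congr rfl fun b _ => by ring
    rw [this]
    refine Finset.sum_le_sum fun b _ => mul_le_mul_of_nonneg_left
      (mul_le_mul_of_nonneg_left ?_ (ξ0 r _ b hr)) (hw b).le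
    linarith [hq b]
  -- Since `1 - q b / t ≤ 1`, the cap `r` is inactive from `r = 1` on. So `T` is constant there and
  -- `E` decays like `1 / r`.
  have hone : ∀ r t b, 1 ≤ r → 0 < t → ξ r t b = ξ 1 t b := by
    intro r t b hr ht
    have h1 : max (1 - q b / t) 0 ≤ 1 :=
      max_le (by have := div_nonneg (hq b) ht.le; linarith) zero_le_one
    simp only [hξ]
    rw [min_eq_right h1, min_eq_right (h1.trans hr)]
  have hT1 : ∀ r, 1 ≤ r → T r = T 1 := by
    intro r hr
    have hr0 := zero_lt_one.trans_le hr
    have hGe : ∀ t, 0 < t → G r t = G 1 t := fun t ht =>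
      Finset.sum_congr rfl fun b _ => by rw [hone r t b hr ht]
    have h1 := hTe r hr0
    have h2 := hTpos r hr0
    rw [hGe _ h2] at h1
    rcases lt_trichotomy (T r) (T 1) with h | h | h
    · exact absurd h1 (hlt 1 _ one_pos h2 h).ne
    · exact h
    · exact absurd h1 (hgt 1 _ one_pos h).ne'
  have hEhigh : ∀ r, 1 ≤ r → E r = E 1 / r := by
    intro r hr
    simp only [hE, hT1 r hr, hone r (T 1) _ hr (hTpos 1 one_pos), div_one]
  -- `E r ≥ RA / r` near zero and `E r = E 1 / r` for `r ≥ 1` place `RB` between the values of `E`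
  -- at `r0` and `r1`.
  set r0 := min 1 (RA / RB) with hr0
  set r1 := max 1 (E 1 / RB) with hr1
  have hr0pos : 0 < r0 := lt_min one_pos (by positivity)
  have hr01 : r0 ≤ r1 := (min_le_left _ _).trans (le_max_left _ _)
  have hA : RB ≤ E r0 := by
    refine le_trans ?_ (hElow r0 hr0pos)
    rw [le_div_iff₀ hr0pos, mul_comm, ← le_div_iff₀ hRB]
    exact min_le_right _ _
  have hB : E r1 ≤ RB := by
    have h1 : 1 ≤ r1 := le_max_left _ _
    rw [hEhigh r1 h1, div_le_iff₀ (by linarith), mul_comm, ← div_le_iff₀ hRB]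
    exact le_max_right _ _
  obtain ⟨r, hr, hre⟩ := intermediate_value_Icc' hr01
    (hEcont.mono fun r hr => hr0pos.trans_le hr.1) ⟨hB, hA⟩
  have hrpos : 0 < r := hr0pos.trans_le hr.1
  have hT0 := hTpos r hrpos
  refine ⟨r * T r, T r, fun b => T r * ξ r (T r) b, by positivity, hT0, fun b => ?_, ?_, ?_⟩
  · simp only [hξ]
    rw [mul_min_of_nonneg _ _ hT0.le, mul_max_of_nonneg _ _ hT0.le, mul_comm r, mul_zero, mul_sub,
      mul_one, mul_div_cancel₀ _ hT0.ne']
  · calc _ = T r * (T r * G r (T r)) := by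
          rw [hG, Finset.mul_sum, Finset.mul_sum]
          exact Finset.sum_congr rfl fun b _ => by ring
      _ = _ := by rw [hTe r hrpos]; ring
  · have : ∑ b, w b * (ξ r (T r) b * (q b + T r * ξ r (T r) b / 2)) = RB * r := by
      rw [← hre]; exact (div_mul_cancel₀ _ hrpos.ne').symm
    calc _ = T r * ∑ b, w b * (ξ r (T r) b * (q b + T r * ξ r (T r) b / 2)) := by
          rw [Finset.mul_sum]
          exact Finset.sum_congr rfl fun b _ => by ring
      _ = _ := by rw [this]; ring

/-! ### Equilibria of the final stage when A has a real-time budget -/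

section equilibrium

variable {n : ℕ} {τ w p : Fin n → ℝ} {RA RB : ℝ}

/-- The mean bid on a battlefield is `w b * x b / 2` times the probability `x b / t` of bidding. -/
lemma rampStrategy_mem_lottoStrategies_of_sum_sq (hw : ∀ b, 0 < w b) {t : ℝ} (ht : 0 < t)
    {x : Fin n → ℝ} (hx0 : ∀ b, 0 ≤ x b) (hxt : ∀ b, x b ≤ t)
    (hcost : ∑ b, w b * x b ^ 2 ≤ 2 * t * RA) :
    rampStrategy (fun b => x b / t) (fun b => w b * x b) (fun b => -(w b * t)) ∈
      lottoStrategies n RA := by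
  refine rampStrategy_mem_lottoStrategies
    (fun b => ⟨div_nonneg (hx0 b) ht.le, (div_le_one ht).2 (hxt b)⟩) (fun b u _ hu => ?_) ?_
  · rw [le_div_iff₀ ht] at hu
    nlinarith [hw b]
  · have : ∑ b, (w b * x b * (x b / t) + -(w b * t) * (x b / t) ^ 2 / 2) =
        (∑ b, w b * x b ^ 2) / (2 * t) := by
      rw [Finset.sum_div]
      refine Finset.sum_congr rfl fun b _ => ?_
      field_simp
      ring
    rw [this, div_le_iff₀ (by positivity)]
    linarith

lemma rampStrategy_mem_lottoStrategies_of_topping (hw : ∀ b, 0 < w b) (hp : ∀ b, 0 ≤ p b) {s : ℝ}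
    (hs : 0 < s) {x : Fin n → ℝ} (hx0 : ∀ b, 0 ≤ x b) (hxs : ∀ b, x b ≤ s)
    (hcost : ∑ b, w b * (x b * (p b / w b + x b / 2)) ≤ s * RB) :
    rampStrategy (fun b => x b / s) p (fun b => w b * s) ∈ lottoStrategies n RB := by
  refine rampStrategy_mem_lottoStrategies
    (fun b => ⟨div_nonneg (hx0 b) hs.le, (div_le_one hs).2 (hxs b)⟩) (fun b u hu _ => ?_) ?_
  · have := hw b
    have := hp b
    positivity
  · have : ∑ b, (p b * (x b / s) + w b * s * (x b / s) ^ 2 / 2) =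
        (∑ b, w b * (x b * (p b / w b + x b / 2))) / s := by
      rw [Finset.sum_div]
      refine Finset.sum_congr rfl fun b _ => ?_
      have := hw b
      field_simp
    rw [this, div_le_iff₀ hs]
    linarith

/-- The budget equations turn the prices times the budgets into sums over battlefields, and the two
guarantees then agree term by term. If `t ≤ q b`, then `x b = 0` and both terms equal `w b`;
otherwise they differ by a multiple of `(s - x b) * (t - (x b + q b))`, which vanishes by
complementary slackness. -/
lemma exists_isSubgameNash (hw : ∀ b, 0 < w b) (hsum : ∑ b, w b = 1)
    (hτ : ∀ b, τ b ∈ Set.Icc (0 : ℝ) 1) (hp : ∀ b, 0 ≤ p b) (hRA : 0 < RA) (hRB : 0 < RB) :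
    ∃ FA FB, IsSubgameNash τ w p RA RB FA FB := by
  have hq : ∀ b, 0 ≤ p b / w b := fun b => div_nonneg (hp b) (hw b).le
  obtain ⟨s, t, x, hs, ht, hx, hA, hB⟩ := exists_budget_multipliers hw hsum hq hRA hRB
  have hx0 : ∀ b, 0 ≤ x b := fun b => by rw [hx]; exact le_min hs.le (le_max_right _ _)
  have hxs : ∀ b, x b ≤ s := fun b => by rw [hx]; exact min_le_left _ _
  have hxt : ∀ b, x b ≤ t := fun b => by
    rw [hx]
    exact (min_le_right _ _).trans (max_le (sub_le_self _ (hq b)) ht.le)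
  have hsaddle : ∑ b, w b * (1 - x b / s) + s⁻¹ * RA ≤
      ∑ b, w b * min 1 ((x b + p b / w b) / t) - t⁻¹ * RB := by
    have e1 : s⁻¹ * RA = ∑ b, w b * (x b ^ 2 / (2 * t * s)) := by
      have : s⁻¹ * RA = (2 * t * RA) / (2 * t * s) := by field_simp
      rw [this, ← hA, Finset.sum_div]
      exact Finset.sum_congr rfl fun b _ => by ring
    have e2 : t⁻¹ * RB = ∑ b, w b * (x b * (p b / w b + x b / 2) / (s * t)) := by
      have : t⁻¹ * RB = (s * RB) / (s * t) := by field_simp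
      rw [this, ← hB, Finset.sum_div]
      exact Finset.sum_congr rfl fun b _ => by ring
    rw [e1, e2, ← Finset.sum_add_distrib, ← Finset.sum_sub_distrib]
    refine Finset.sum_le_sum fun b _ => ?_
    rw [← mul_add, ← mul_sub]
    refine mul_le_mul_of_nonneg_left ?_ (hw b).le
    have hxb := hx b
    generalize p b / w b = q at *
    rcases le_total t q with htq | htq
    · rw [max_eq_right (by linarith), min_eq_right hs.le] at hxb
      have : 1 ≤ q / t := (one_le_div ht).2 htq
      simp [hxb, this]
    · rw [max_eq_left (by linarith)] at hxb
      have h1 : x b + q ≤ t := by have := min_le_right s (t - q); linarith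
      rw [min_eq_right ((div_le_one ht).2 h1)]
      have h2 : (s - x b) * (t - (x b + q)) = 0 := by
        rcases min_choice s (t - q) with h | h <;> rw [hxb, h] <;> ring
      have h3 : (x b + q) / t - x b * (q + x b / 2) / (s * t) -
          (1 - x b / s + x b ^ 2 / (2 * t * s)) = -((s - x b) * (t - (x b + q))) / (s * t) := by
        field_simp
        ring
      rw [h2] at h3
      simp at h3
      linarith
  refine ⟨_, _, isSubgameNash_of_guarantees
    (rampStrategy_mem_lottoStrategies_of_sum_sq hw ht hx0 hxt hA.le)
    (rampStrategy_mem_lottoStrategies_of_topping hw hp hs hx0 hxs hB.le)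
    (fun F hF => le_payoffA_rampStrategy hw hsum hτ hRB.le ht x hF)
    (fun F hF => (payoffA_rampStrategy_le hw hsum hτ hRA.le hs hxs hF).trans hsaddle)⟩

end equilibrium

/-! ### Equilibria of the final stage when A has no real-time budget -/

section noBudget

variable {n : ℕ} {τ w p : Fin n → ℝ} {RB : ℝ}

lemma dirac_zero_mem_lottoStrategies {R : ℝ} :
    Measure.dirac (0 : Fin n → ℝ) ∈ lottoStrategies n R := by
  refine ⟨inferInstance, ?_, ?_⟩
  · rw [ae_dirac_eq]
    simp
  · rw [lintegral_dirac]
    simp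

lemma eq_dirac_zero_of_mem_lottoStrategies {F : Measure (Fin n → ℝ)}
    (hF : F ∈ lottoStrategies n 0) : F = Measure.dirac 0 := by
  obtain ⟨hprob, h0, hR⟩ := hF
  rw [ENNReal.ofReal_zero, nonpos_iff_eq_zero, lintegral_eq_zero_iff (by fun_prop)] at hR
  have hae : id =ᵐ[F] fun _ => (0 : Fin n → ℝ) := by
    filter_upwards [h0, hR] with x hx hx0
    ext b
    have := (Finset.sum_eq_zero_iff_of_nonneg fun b _ => zero_le).1 hx0 b (Finset.mem_univ b)
    exact le_antisymm (ENNReal.ofReal_eq_zero.1 this) (hx b)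
  calc F = F.map id := Measure.map_id.symm
    _ = F.map fun _ => 0 := Measure.map_congr hae
    _ = Measure.dirac 0 := by rw [Measure.map_const]; simp

lemma payoffA_dirac_zero (hw : ∀ b, 0 < w b) (hsum : ∑ b, w b = 1)
    (hτ : ∀ b, τ b ∈ Set.Icc (0 : ℝ) 1) (F : Measure (Fin n → ℝ)) [IsProbabilityMeasure F] :
    payoffA τ w p (Measure.dirac 0) F = ∫ y, totalShare τ w p 0 y ∂F := by
  rw [payoffA_eq_integral, integral_prod _
    (integrable_totalShare hw hsum hτ p _ measurable_fst measurable_snd), integral_dirac]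

lemma isSubgameNash_dirac_zero {FB : Measure (Fin n → ℝ)} (hB : FB ∈ lottoStrategies n RB)
    (h : ∀ F ∈ lottoStrategies n RB,
      payoffA τ w p (Measure.dirac 0) FB ≤ payoffA τ w p (Measure.dirac 0) F) :
    IsSubgameNash τ w p 0 RB (Measure.dirac 0) FB :=
  ⟨dirac_zero_mem_lottoStrategies, hB,
    fun F hF => by rw [eq_dirac_zero_of_mem_lottoStrategies hF],
    fun F hF => sub_le_sub_left (h F hF) 1⟩

lemma payoffA_dirac_zero_rampStrategy_le (hw : ∀ b, 0 < w b) (hsum : ∑ b, w b = 1)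
    (hτ : ∀ b, τ b ∈ Set.Icc (0 : ℝ) 1) {k c : Fin n → ℝ} (hk : ∀ b, k b ≤ 1)
    (h : ∀ b, winShare (τ b) (p b) (c b) = 0) :
    payoffA τ w p (Measure.dirac 0) (rampStrategy k c 0) ≤ ∑ b, w b * (1 - k b) := by
  rw [payoffA_dirac_zero hw hsum hτ, integral_totalShare_rampStrategy_right hτ]
  refine Finset.sum_le_sum fun b _ => mul_le_mul_of_nonneg_left ?_ (hw b).le
  refine (integral_unitUniform_le (measurable_winShare _
    measurable_const (measurable_rampAllocation_apply b))
    (fun u => winShare_mem_Icc (hτ b) _ _) le_rfl (hk b) fun u _ hu => ?_).trans (by simp)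
  simp [rampAllocation, hu.le, h]

/-- B can afford to exceed every pre-allocation strictly by sharing out the surplus `RB - P`, so
ties never occur and A gets nothing. -/
lemma exists_isSubgameNash_of_preallocation_lt (hw : ∀ b, 0 < w b) (hsum : ∑ b, w b = 1)
    (hτ : ∀ b, τ b ∈ Set.Icc (0 : ℝ) 1) {P : ℝ} (hp : p ∈ preallocations n P) (hP : P < RB) :
    ∃ FA FB, IsSubgameNash τ w p 0 RB FA FB := by
  have h0 : ∀ b, 0 < w b * (RB - P) := fun b => mul_pos (hw b) (sub_pos.2 hP)
  refine ⟨_, rampStrategy 1 (fun b => p b + w b * (RB - P)) 0, isSubgameNash_dirac_zero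
    (rampStrategy_mem_lottoStrategies (fun b => by simp) (fun b u _ _ => ?_) ?_) fun F _ =>
    le_trans ?_ (payoffA_nonneg hw hτ p _ F)⟩
  · have := h0 b
    have := hp.1 b
    simp only [Pi.zero_apply, zero_mul, add_zero]
    linarith
  · simp [Finset.sum_add_distrib, ← Finset.sum_mul, hsum, hp.2]
  · refine (payoffA_dirac_zero_rampStrategy_le hw hsum hτ (fun b => le_rfl) fun b =>
      winShare_of_gt ?_).trans (by simp)
    linarith [h0 b]

/-- Markov's inequality: `k b` is the probability that B reaches `p b`, and doing so costs at least
`p b`. When ties go to B, the payoff depends on these probabilities alone. -/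
lemma exists_le_payoffA_dirac_zero (hw : ∀ b, 0 < w b) (hsum : ∑ b, w b = 1)
    (hRB : 0 ≤ RB) {F : Measure (Fin n → ℝ)} (hF : F ∈ lottoStrategies n RB) :
    ∃ k : Fin n → ℝ, (∀ b, k b ∈ Set.Icc (0 : ℝ) 1) ∧ ∑ b, k b * p b ≤ RB ∧
      ∑ b, w b * (1 - k b) ≤ payoffA (fun _ => 0) w p (Measure.dirac 0) F := by
  have := hF.1
  have hS : ∀ b, MeasurableSet {y : Fin n → ℝ | p b ≤ y b} := fun b =>
    measurableSet_le measurable_const (measurable_pi_apply b)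
  have hind : ∀ (b) (a : ℝ), Integrable ({y : Fin n → ℝ | p b ≤ y b}.indicator fun _ => a) F :=
    fun b a => (integrable_const a).indicator (hS b)
  refine ⟨fun b => F.real {y | p b ≤ y b}, fun b => ⟨measureReal_nonneg, measureReal_le_one⟩, ?_, ?_⟩
  · refine le_trans ?_ (integral_sum_le_of_mem_lottoStrategies hRB hF)
    calc ∑ b, F.real {y | p b ≤ y b} * p b =
          ∫ y, ∑ b, {y : Fin n → ℝ | p b ≤ y b}.indicator (fun _ => p b) y ∂F := by
          rw [integral_finsetSum _ fun b _ => hind b _]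
          refine Finset.sum_congr rfl fun b _ => ?_
          rw [integral_indicator (hS b)]
          simp
      _ ≤ _ := by
          refine integral_mono_ae (integrable_finsetSum _ fun b _ => hind b _)
            (integrable_sum_of_mem_lottoStrategies hF) ?_
          filter_upwards [hF.2.1] with y hy
          refine Finset.sum_le_sum fun b _ => ?_
          by_cases h : p b ≤ y b
          · simp [h]
          · simpa [h] using hy b
  · rw [payoffA_dirac_zero hw hsum fun b => by simp]
    have e : ∀ y, totalShare (fun _ => 0) w p 0 y =
        ∑ b, w b * (1 - {y : Fin n → ℝ | p b ≤ y b}.indicator (fun _ => (1 : ℝ)) y) := by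
      intro y
      refine Finset.sum_congr rfl fun b _ => ?_
      by_cases h : p b ≤ y b
      · have : ¬ y b < p b := h.not_gt
        simp [winShare, h, this]
      · simp [winShare, h, not_le.1 h]
    simp_rw [e]
    have hint : ∀ b, Integrable (fun y => w b *
        (1 - {y : Fin n → ℝ | p b ≤ y b}.indicator (fun _ => (1 : ℝ)) y)) F := fun b =>
      ((integrable_const _).sub (hind b 1)).const_mul _
    rw [integral_finsetSum _ fun b _ => hint b]
    refine Finset.sum_le_sum fun b _ => ?_
    rw [integral_const_mul, integral_sub (integrable_const _) (hind b 1),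
      integral_indicator (hS b)]
    simp

/-- B solves a fractional knapsack problem in the probabilities of matching `p b`, and compactness
gives an optimum. It is realised only because matching wins; under other rules the infimum need not
be attained. -/
lemma exists_isSubgameNash_of_tie_zero (hw : ∀ b, 0 < w b) (hsum : ∑ b, w b = 1)
    (hp : ∀ b, 0 ≤ p b) (hRB : 0 ≤ RB) :
    ∃ FA FB, IsSubgameNash (fun _ => 0) w p 0 RB FA FB := by
  set K : Set (Fin n → ℝ) :=
    Set.univ.pi (fun _ => Set.Icc (0 : ℝ) 1) ∩ {k | ∑ b, k b * p b ≤ RB} with hK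
  have hKc : IsCompact K := (isCompact_univ_pi fun _ => isCompact_Icc).inter_right
    (isClosed_le (by fun_prop) continuous_const)
  obtain ⟨k, hk, hmin⟩ := hKc.exists_isMinOn (f := fun k => ∑ b, w b * (1 - k b))
    ⟨0, fun b _ => by simp, by simpa using hRB⟩ (by fun_prop)
  have hk1 : ∀ b, k b ∈ Set.Icc (0 : ℝ) 1 := fun b => hk.1 b (Set.mem_univ b)
  refine ⟨_, rampStrategy k p 0, isSubgameNash_dirac_zero (rampStrategy_mem_lottoStrategies hk1
    (fun b u _ _ => by simpa using hp b) ?_) fun F hF => ?_⟩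
  · simpa [mul_comm] using hk.2
  · obtain ⟨k', h1, h2, h3⟩ := exists_le_payoffA_dirac_zero hw hsum hRB hF
    refine (payoffA_dirac_zero_rampStrategy_le hw hsum (fun b => by simp) (fun b => (hk1 b).2)
      fun b => by simp [winShare]).trans (le_trans ?_ h3)
    exact hmin (show k' ∈ K from ⟨fun b _ => h1 b, h2⟩)

end noBudget

/-! ### The value of the two-stage game and its level curves -/

section value

variable {n : ℕ} {τ w : Fin n → ℝ} {P RA RB : ℝ}

lemma smul_mem_preallocations (hw : ∀ b, 0 < w b) (hsum : ∑ b, w b = 1) (hP : 0 ≤ P) :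
    (fun b => w b * P) ∈ preallocations n P :=
  ⟨fun b => mul_nonneg (hw b).le hP, by rw [← Finset.sum_mul, hsum, one_mul]⟩

/-- `V` bounds the payoff of `A` in all final stages, and is attained for the pre-allocation
proportional to the values of the battlefields. -/
def IsGameValue {n : ℕ} (τ w : Fin n → ℝ) (P RA RB V : ℝ) : Prop :=
  (∀ p ∈ preallocations n P, ∀ FA FB, IsSubgameNash τ w p RA RB FA FB →
    payoffA τ w p FA FB ≤ V) ∧
  ∀ FA FB, IsSubgameNash τ w (fun b => w b * P) RA RB FA FB →
    V ≤ payoffA τ w (fun b => w b * P) FA FB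

lemma IsGameValue.eq_of_isSPEPayoffA {V v : ℝ} (h : IsGameValue τ w P RA RB V)
    (hw : ∀ b, 0 < w b) (hsum : ∑ b, w b = 1) (hP : 0 ≤ P)
    (hv : IsSPEPayoffA τ w P RA RB v) : v = V := by
  obtain ⟨p, FA, FB, ⟨hp, hN, hmax⟩, rfl⟩ := hv
  have hm := smul_mem_preallocations hw hsum hP
  exact le_antisymm (h.1 p hp _ _ (hN p hp)) ((h.2 _ _ (hN _ hm)).trans (hmax _ hm))

lemma IsGameValue.isSPEPayoffA {V : ℝ} (h : IsGameValue τ w P RA RB V)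
    (hw : ∀ b, 0 < w b) (hsum : ∑ b, w b = 1) (hP : 0 ≤ P)
    (hN : ∀ p ∈ preallocations n P, ∃ FA FB, IsSubgameNash τ w p RA RB FA FB) :
    IsSPEPayoffA τ w P RA RB V := by
  choose! FA FB hF using hN
  have hm := smul_mem_preallocations hw hsum hP
  refine ⟨_, FA, FB, ⟨hm, hF, fun p hp => ?_⟩, ?_⟩
  · exact (h.1 p hp _ _ (hF p hp)).trans (h.2 _ _ (hF _ hm))
  · exact le_antisymm (h.1 _ hm _ _ (hF _ hm)) (h.2 _ _ (hF _ hm))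

/-- The equations for the multipliers `s`, `t` and the length `x` of the bidding interval in the
final stage after the proportional pre-allocation. -/
def IsProportionalSolution (P RA RB s t x : ℝ) : Prop :=
  0 < x ∧ x ≤ s ∧ x + P ≤ t ∧ (x = s ∨ x + P = t) ∧ x ^ 2 = 2 * t * RA ∧ x * (P + x / 2) = s * RB

lemma exists_isProportionalSolution (hP : 0 ≤ P) (hRA : 0 < RA) (hRB : 0 < RB) :
    ∃ s t x, IsProportionalSolution P RA RB s t x := by
  -- The proportional pre-allocation makes `p b / w b` equal to `P` everywhere, so a single
  -- battlefield of value one gives the equations.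
  obtain ⟨s, t, x, hs, ht, hx, hA, hB⟩ := exists_budget_multipliers (n := 1) (w := fun _ => 1)
    (q := fun _ => P) (fun _ => one_pos) (by simp) (fun _ => hP) hRA hRB
  simp only [Finset.univ_unique, Finset.sum_singleton, one_mul] at hA hB
  have hx0 := hx default
  have h1 : x default ≠ 0 := by
    intro h
    rw [h] at hA
    have : 0 < 2 * t * RA := by positivity
    linarith
  have h2 : P < t := by
    by_contra! h
    rw [max_eq_right (by linarith), min_eq_right hs.le] at hx0
    exact h1 hx0
  rw [max_eq_left (by linarith)] at hx0
  refine ⟨s, t, x default, ?_, ?_, ?_, ?_, hA, hB⟩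
  · rw [hx0]; exact lt_min hs (by linarith)
  · rw [hx0]; exact min_le_left _ _
  · have := min_le_right s (t - P)
    linarith
  · rcases min_choice s (t - P) with h | h
    · left; rw [hx0, h]
    · right; rw [hx0, h]; ring

/-- The upper bound uses B's strategy with constant `x` against every `p`; its cost involves `p`
only through the total `P`. The lower bound is A's guarantee after the proportional pre-allocation.
-/
lemma IsProportionalSolution.isGameValue {s t x : ℝ} (h : IsProportionalSolution P RA RB s t x)
    (hw : ∀ b, 0 < w b) (hsum : ∑ b, w b = 1) (hτ : ∀ b, τ b ∈ Set.Icc (0 : ℝ) 1)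
    (hP : 0 ≤ P) (hRA : 0 ≤ RA) (hRB : 0 ≤ RB) :
    IsGameValue τ w P RA RB ((x + P - RB) / t) := by
  obtain ⟨hx, hxs, hxt, hor, hA, hB⟩ := h
  have hs : 0 < s := hx.trans_le hxs
  have ht : 0 < t := by linarith
  refine ⟨fun p hp FA FB hN => ?_, fun FA FB hN => ?_⟩
  · have hcost : ∑ b, w b * (x * (p b / w b + x / 2)) ≤ s * RB := by
      have : ∀ b, w b * (x * (p b / w b + x / 2)) = x * p b + w b * (x * (x / 2)) := fun b => by
        have := hw b
        field_simp
      simp_rw [this]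
      rw [Finset.sum_add_distrib, ← Finset.mul_sum, ← Finset.sum_mul, hsum, hp.2]
      linarith
    have hval : (x + P - RB) / t = ∑ b, w b * (1 - x / s) + s⁻¹ * RA := by
      rw [← Finset.sum_mul, hsum, one_mul]
      have h1 : RA = x ^ 2 / (2 * t) := by rw [hA]; field_simp
      have h2 : RB = x * (P + x / 2) / s := by rw [hB]; field_simp
      have h3 : (s - x) * (t - (x + P)) = 0 := by
        rcases hor with h | h <;> rw [h] <;> ring
      have h4 : (x + P - x * (P + x / 2) / s) / t - (1 - x / s + s⁻¹ * (x ^ 2 / (2 * t))) =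
          -((s - x) * (t - (x + P))) / (s * t) := by
        field_simp
        ring
      rw [h3] at h4
      rw [h1, h2]
      simp at h4
      linarith
    rw [hval]
    exact hN.payoffA_le (rampStrategy_mem_lottoStrategies_of_topping hw hp.1 hs (fun _ => hx.le)
      (fun _ => hxs) hcost) fun F hF => payoffA_rampStrategy_le hw hsum hτ hRA hs (fun _ => hxs) hF
  · refine hN.le_payoffA (rampStrategy_mem_lottoStrategies_of_sum_sq hw ht (x := fun _ => x)
      (fun _ => hx.le) (fun _ => by linarith) ?_) fun F hF =>
      le_trans ?_ (le_payoffA_rampStrategy hw hsum hτ hRB ht _ hF)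
    · rw [← Finset.sum_mul, hsum, one_mul, hA]
    · have : ∀ b, w b * min 1 ((x + w b * P / w b) / t) = w b * ((x + P) / t) := fun b => by
        rw [mul_div_cancel_left₀ _ (hw b).ne', min_eq_right ((div_le_one ht).2 hxt)]
      simp_rw [this]
      rw [← Finset.sum_mul, hsum, one_mul, sub_div, div_eq_inv_mul RB]

/-- For any `k ≤ 1` with `k * P < RB`, B can exceed every `p b` with probability `k`; the upper
bound follows as `k` approaches `min 1 (RB / P)`. Strict outbidding makes this independent of ties.
-/
lemma isGameValue_zero (hw : ∀ b, 0 < w b) (hsum : ∑ b, w b = 1)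
    (hτ : ∀ b, τ b ∈ Set.Icc (0 : ℝ) 1) (hP : 0 ≤ P) (hRB : 0 < RB) :
    IsGameValue τ w P 0 RB (if P ≤ RB then 0 else 1 - RB / P) := by
  have hup : ∀ p ∈ preallocations n P, ∀ FA FB, IsSubgameNash τ w p 0 RB FA FB →
      ∀ k, 0 ≤ k → k ≤ 1 → k * P < RB → payoffA τ w p FA FB ≤ 1 - k := by
    intro p hp FA FB hN k hk0 hk1 hkP
    -- Chosen so that the expected cost `k * P + k ^ 2 * s / 2` is at most `k * P + s / 2 = RB`.
    set s := 2 * (RB - k * P) with hs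
    have hs0 : 0 < s := by linarith
    have hxs : k * s ≤ s := mul_le_of_le_one_left hs0.le hk1
    refine hN.payoffA_le (rampStrategy_mem_lottoStrategies_of_topping hw hp.1 hs0
      (x := fun _ => k * s) (fun _ => by positivity) (fun _ => hxs) ?_) fun F hF =>
      (payoffA_rampStrategy_le hw hsum hτ le_rfl hs0 (fun _ => hxs) hF).trans (le_of_eq ?_)
    · have : ∀ b, w b * (k * s * (p b / w b + k * s / 2)) =
          k * s * p b + w b * (k * s * (k * s / 2)) := fun b => by
        have := hw b
        field_simp
      simp_rw [this]
      rw [Finset.sum_add_distrib, ← Finset.mul_sum, ← Finset.sum_mul, hsum, hp.2]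
      have : k * P + k * (k * s / 2) ≤ RB := by
        have : k * (k * s) ≤ 1 * s := by gcongr
        linarith
      nlinarith
    · rw [← Finset.sum_mul, hsum, mul_div_cancel_right₀ _ hs0.ne']
      simp
  split_ifs with hPR
  · refine ⟨fun p hp FA FB hN => ?_, fun FA FB _ => payoffA_nonneg hw hτ _ _ _⟩
    by_contra! hpos
    set v := payoffA τ w p FA FB
    have hlt : (1 - min 1 v / 2) * P < RB := by
      have h1 : 0 < min 1 v := lt_min one_pos hpos
      rcases hP.eq_or_lt with h | h
      · rw [← h]; linarith
      · nlinarith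
    have h2 := hup p hp FA FB hN (1 - min 1 v / 2) (by linarith [min_le_left 1 v])
      (by linarith [lt_min one_pos hpos]) hlt
    linarith [min_le_right 1 v]
  · rw [not_le] at hPR
    have hP0 : 0 < P := hRB.trans hPR
    refine ⟨fun p hp FA FB hN => ?_, fun FA FB hN => ?_⟩
    · by_contra! hlt
      set v := payoffA τ w p FA FB
      have h1 : RB / P < 1 := (div_lt_one hP0).2 hPR
      obtain ⟨k, hk1, hk2⟩ := exists_between
        (max_lt (by linarith : 1 - v < RB / P) (div_pos hRB hP0))
      have h2 := hup p hp FA FB hN k ((le_max_right _ _).trans hk1.le) (by linarith)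
        ((lt_div_iff₀ hP0).1 hk2)
      linarith [le_max_left (1 - v) 0]
    -- With `x = 0` and `t = P` A bids nothing, and the general guarantee reads `1 - RB / P`.
    · refine hN.le_payoffA (rampStrategy_mem_lottoStrategies_of_sum_sq hw hP0 (x := fun _ => 0)
        (fun _ => le_rfl) (fun _ => hP0.le) (by simp)) fun F hF =>
        le_trans (le_of_eq ?_) (le_payoffA_rampStrategy hw hsum hτ hRB.le hP0 _ hF)
      have : ∀ b, w b * min 1 ((0 + w b * P / w b) / P) = w b := fun b => by
        rw [mul_div_cancel_left₀ _ (hw b).ne', zero_add, div_self hP0.ne', min_self, mul_one]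
      simp_rw [this]
      rw [hsum, div_eq_inv_mul]

lemma IsProportionalSolution.levelFn_eq {s t x : ℝ} (h : IsProportionalSolution P RA RB s t x)
    (hP : 0 ≤ P) (hRB : 0 < RB) :
    (x + P - RB) / t < 1 ∧ P ≤ RB / (1 - (x + P - RB) / t) ∧
      RA = levelFn RB ((x + P - RB) / t) P := by
  obtain ⟨hx, hxs, hxt, hor, hA, hB⟩ := h
  have ht : 0 < t := by linarith
  have hA' : RA = x ^ 2 / (2 * t) := by rw [hA]; field_simp
  have hV1 : (x + P - RB) / t < 1 := by rw [div_lt_one ht]; linarith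
  have hV : 1 - (x + P - RB) / t = (t - (x + P) + RB) / t := by field_simp; ring
  have hpos : 0 < t - (x + P) + RB := by linarith
  -- On the branch `x + P = t`, B's budget equation and `x ≤ s` give `P + x / 2 ≥ RB`. This places
  -- `P` at or beyond the breakpoint `2 * RB - t` of `levelFn`.
  have hsq : x + P = t → 2 * RB ≤ t + P := by
    intro h
    have h1 : x * (P + x / 2) ≥ x * RB := by rw [hB]; gcongr
    have := le_of_mul_le_mul_left h1 hx
    linarith
  refine ⟨hV1, ?_, ?_⟩
  · rw [hV, div_div_eq_mul_div, le_div_iff₀ hpos]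
    rcases hor with h | h
    · subst h
      have : P + x / 2 = RB := mul_left_cancel₀ hx.ne' hB
      nlinarith
    · rw [h]
      nlinarith
  · by_cases h : x + P = t
    · have hc : ¬ ((x + P - RB) / t < 1 / 2 ∧
          P < (1 - 2 * ((x + P - RB) / t)) * RB / (1 - (x + P - RB) / t)) := by
        rintro ⟨-, h2⟩
        have e : (1 - 2 * ((x + P - RB) / t)) * RB / (1 - (x + P - RB) / t) = 2 * RB - t := by
          rw [hV, h]
          field_simp
          ring
        have := hsq h
        linarith
      rw [levelFn, if_neg hc, hV, hA', h]
      have : x = t - P := by linarith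
      rw [this]
      field_simp
      ring
    · have hs := hor.resolve_right h
      subst hs
      have hR : RB = P + x / 2 := (mul_left_cancel₀ hx.ne' hB).symm
      have hlt : x + P < t := lt_of_le_of_ne hxt h
      have hc : (x + P - RB) / t < 1 / 2 ∧
          P < (1 - 2 * ((x + P - RB) / t)) * RB / (1 - (x + P - RB) / t) := by
        constructor
        · rw [div_lt_iff₀ ht]; linarith
        · rw [lt_div_iff₀ (by linarith), hV, hR]
          have e : (1 - 2 * ((x + P - (P + x / 2)) / t)) * (P + x / 2) -
              P * ((t - (x + P) + (P + x / 2)) / t) = x * (t - (x + P)) / (2 * t) := by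
            field_simp
            ring
          have : 0 < x * (t - (x + P)) / (2 * t) := by
            have : 0 < t - (x + P) := by linarith
            positivity
          linarith
      rw [levelFn, if_pos hc, hA', hR]
      field_simp
      ring

lemma levelFn_nonneg {c : ℝ} (hc : 0 ≤ c) (hc1 : c < 1) (hRB : 0 < RB) : 0 ≤ levelFn RB c P := by
  have h1 : 0 < 1 - c := by linarith
  unfold levelFn
  split_ifs with h
  · obtain ⟨-, h⟩ := h
    rw [lt_div_iff₀ h1] at h
    have : P ≤ RB := by nlinarith
    have : 0 ≤ RB - P := by linarith
    positivity
  · positivity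

/-- A point of the graph of `levelFn` has the equilibrium payoff `c`. -/
lemma isGameValue_levelFn {c : ℝ} (hc : 0 ≤ c) (hc1 : c < 1)
    (hw : ∀ b, 0 < w b) (hsum : ∑ b, w b = 1) (hτ : ∀ b, τ b ∈ Set.Icc (0 : ℝ) 1)
    (hP : 0 ≤ P) (hPc : P ≤ RB / (1 - c)) (hRB : 0 < RB) :
    IsGameValue τ w P (levelFn RB c P) RB c := by
  have h1 : 0 < 1 - c := by linarith
  have hRA := levelFn_nonneg (P := P) hc hc1 hRB
  have hPc' := hPc
  rw [le_div_iff₀ h1] at hPc'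
  by_cases h : c < 1 / 2 ∧ P < (1 - 2 * c) * RB / (1 - c)
  · obtain ⟨h2, h3⟩ := id h
    rw [lt_div_iff₀ h1] at h3
    have hPR : P < RB := by nlinarith
    rw [levelFn, if_pos h] at hRA ⊢
    rcases hc.eq_or_lt with h0 | h0
    · subst h0
      have := isGameValue_zero (τ := τ) hw hsum hτ hP hRB
      rw [if_pos hPR.le] at this
      simpa using this
    · have hx : 0 < RB - P := by linarith
      -- On the linear branch `x = s`: B's equation gives `x = 2 * (RB - P)`, and the value `(RB -
      -- P) / t = c` gives `t`.
      have hsol : IsProportionalSolution P (2 * c * (RB - P)) RB (2 * (RB - P)) ((RB - P) / c)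
          (2 * (RB - P)) := by
        refine ⟨by linarith, le_rfl, ?_, Or.inl rfl, ?_, ?_⟩
        · rw [le_div_iff₀ h0]; nlinarith
        · field_simp
        · ring
      convert hsol.isGameValue (τ := τ) hw hsum hτ hP hRA hRB.le using 1
      field_simp
      ring
  · rw [levelFn, if_neg h] at hRA ⊢
    have h4 : (1 - 2 * c) * RB ≤ P * (1 - c) := by
      rw [not_and_or, not_lt, not_lt] at h
      rcases h with h | h
      · have : 0 ≤ P * (1 - c) := by positivity
        nlinarith
      · exact (div_le_iff₀ h1).1 h
    rcases hPc.eq_or_lt with h5 | h5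
    · have e : (RB - (1 - c) * P) ^ 2 / (2 * RB * (1 - c)) = 0 := by
        rw [h5]; field_simp; simp
      rw [e]
      have := isGameValue_zero (τ := τ) hw hsum hτ hP hRB
      convert this using 1
      split_ifs with h6
      · rw [h5, div_le_iff₀ h1] at h6
        nlinarith
      · rw [h5]; field_simp; ring
    · have hx : 0 < RB / (1 - c) - P := by linarith
      -- On the quadratic branch `x = t - P`: the value `1 - RB / t = c` gives `t`, and B's equation
      -- gives `s`. The branch condition amounts to `x ≤ s`.
      have hsol : IsProportionalSolution P ((RB - (1 - c) * P) ^ 2 / (2 * RB * (1 - c))) RB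
          ((RB / (1 - c) - P) * (RB / (1 - c) + P) / (2 * RB)) (RB / (1 - c))
          (RB / (1 - c) - P) := by
        refine ⟨hx, ?_, by linarith, Or.inr (by ring), ?_, ?_⟩
        · rw [le_div_iff₀ (by positivity)]
          refine mul_le_mul_of_nonneg_left ?_ hx.le
          have : 2 * RB - P ≤ RB / (1 - c) := by
            rw [le_div_iff₀ h1]; nlinarith
          linarith
        · field_simp
        · field_simp
          ring
      convert hsol.isGameValue (τ := τ) hw hsum hτ hP hRA hRB.le using 1
      field_simp
      ring

/-- The value of the game exists, does not depend on the tie-breaking rule, and lies on the graph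
of `levelFn`. -/
lemma exists_isGameValue (hw : ∀ b, 0 < w b) (hsum : ∑ b, w b = 1)
    (hP : 0 ≤ P) (hRA : 0 ≤ RA) (hRB : 0 < RB) :
    ∃ V, (∀ τ : Fin n → ℝ, (∀ b, τ b ∈ Set.Icc (0 : ℝ) 1) → IsGameValue τ w P RA RB V) ∧
      V < 1 ∧ P ≤ RB / (1 - V) ∧ RA = levelFn RB V P := by
  rcases hRA.eq_or_lt with h | h
  · subst h
    refine ⟨_, fun τ hτ => isGameValue_zero hw hsum hτ hP hRB, ?_⟩
    split_ifs with hPR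
    · refine ⟨one_pos, by simpa using hPR, ?_⟩
      unfold levelFn
      split_ifs with h'
      · simp
      · have : P = RB := by
          simp at h'
          linarith
        simp [this]
    · rw [not_le] at hPR
      have hP0 : 0 < P := hRB.trans hPR
      have h1 : RB / P < 1 := (div_lt_one hP0).2 hPR
      have h2 : 0 < RB / P := div_pos hRB hP0
      have e : 1 - (1 - RB / P) = RB / P := by ring
      refine ⟨by linarith, by rw [e]; field_simp; exact le_rfl, ?_⟩
      rw [levelFn, if_neg, e]
      · field_simp; simp
      · rintro ⟨-, h'⟩
        rw [e, lt_div_iff₀ h2] at h'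
        have : P * (RB / P) = RB := by field_simp
        nlinarith
  · obtain ⟨s, t, x, hsol⟩ := exists_isProportionalSolution hP h hRB
    exact ⟨_, fun τ hτ => hsol.isGameValue hw hsum hτ hP hRA hRB.le, hsol.levelFn_eq hP hRB⟩

lemma exists_isSubgameNash_of_mem_preallocations (hw : ∀ b, 0 < w b) (hsum : ∑ b, w b = 1)
    (hτ : ∀ b, τ b ∈ Set.Icc (0 : ℝ) 1) (hRA : 0 ≤ RA) (hRB : 0 < RB)
    (h : 0 < RA ∨ P < RB ∨ τ = fun _ => 0) {p : Fin n → ℝ} (hp : p ∈ preallocations n P) :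
    ∃ FA FB, IsSubgameNash τ w p RA RB FA FB := by
  rcases hRA.eq_or_lt with h0 | h0
  · subst h0
    rcases h with h | h | rfl
    · exact absurd h (lt_irrefl _)
    · exact exists_isSubgameNash_of_preallocation_lt hw hsum hτ hp h
    · exact exists_isSubgameNash_of_tie_zero hw hsum hp.1 hRB.le
  · exact exists_isSubgameNash hw hsum hτ hp.1 h0 hRB

end value

/-! ### The main theorem -/

theorem mainTheorem5 {n : ℕ} (w : Fin n → ℝ) (hw : ∀ b, 0 < w b) (hsum : ∑ b, w b = 1)
    (RB : ℝ) (hRB : 0 < RB) (c : ℝ) (hc : c ∈ Set.Icc (0 : ℝ) 1) :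
    -- the equilibrium payoff is well defined for all endowments (ties won by player `B`)
    (∀ P RA : ℝ, 0 ≤ P → 0 ≤ RA → ∃! v : ℝ, IsSPEPayoffA (fun _ => 0) w P RA RB v) ∧
    -- the level curve
    (c < 1 → levelCurve (fun _ => 0) w RB c =
      {q | ∃ P ∈ Set.Icc (0 : ℝ) (RB / (1 - c)), q = (P, levelFn RB c P)}) ∧
    (c < 1 → ∀ P RA v : ℝ, RB / (1 - c) < P → 0 ≤ RA →
      IsSPEPayoffA (fun _ => 0) w P RA RB v → c < v) ∧
    (c = 1 → levelCurve (fun _ => 0) w RB c = ∅) ∧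
    -- the tie-breaking rule is immaterial
    (∀ τ : Fin n → ℝ, (∀ b, τ b ∈ Set.Icc (0 : ℝ) 1) → ∀ P RA : ℝ, 0 ≤ P → 0 ≤ RA →
      ((0 < RA ∨ P < RB) → ∃ v : ℝ, IsSPEPayoffA τ w P RA RB v) ∧
      (∀ v : ℝ, IsSPEPayoffA τ w P RA RB v → IsSPEPayoffA (fun _ => 0) w P RA RB v)) := by
  have hτ0 : ∀ b : Fin n, (fun _ => 0 : Fin n → ℝ) b ∈ Set.Icc (0 : ℝ) 1 := fun b => by simp
  have hex0 : ∀ {P RA V : ℝ}, 0 ≤ P → 0 ≤ RA → IsGameValue (fun _ => 0) w P RA RB V →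
      IsSPEPayoffA (fun _ => 0) w P RA RB V := fun hP hRA h =>
    h.isSPEPayoffA hw hsum hP fun p hp => exists_isSubgameNash_of_mem_preallocations hw hsum hτ0
      hRA hRB (Or.inr (Or.inr rfl)) hp
  have hval : ∀ {P RA v : ℝ}, 0 ≤ P → 0 ≤ RA → IsSPEPayoffA (fun _ => 0) w P RA RB v →
      v < 1 ∧ P ≤ RB / (1 - v) ∧ RA = levelFn RB v P := by
    intro P RA v hP hRA hv
    obtain ⟨V, hV, h⟩ := exists_isGameValue hw hsum hP hRA hRB
    rwa [(hV _ hτ0).eq_of_isSPEPayoffA hw hsum hP hv]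
  refine ⟨fun P RA hP hRA => ?_, fun hc1 => ?_, fun hc1 P RA v hPc hRA hv => ?_, fun hc1 => ?_,
    fun τ hτ P RA hP hRA => ?_⟩
  · obtain ⟨V, hV, -⟩ := exists_isGameValue hw hsum hP hRA hRB
    exact ⟨V, hex0 hP hRA (hV _ hτ0), fun v hv => (hV _ hτ0).eq_of_isSPEPayoffA hw hsum hP hv⟩
  · ext ⟨P, RA⟩
    constructor
    · rintro ⟨hP, hRA, hv⟩
      obtain ⟨-, h2, h3⟩ := hval hP hRA hv
      exact ⟨P, ⟨hP, h2⟩, Prod.ext rfl h3⟩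
    · rintro ⟨P', ⟨hP, hPc⟩, h⟩
      obtain ⟨rfl, rfl⟩ := Prod.mk.inj h
      have hRA := levelFn_nonneg (P := P) hc.1 hc1 hRB
      exact ⟨hP, hRA, hex0 hP hRA (isGameValue_levelFn hc.1 hc1 hw hsum hτ0 hP hPc hRB)⟩
  · have h1 : 0 < 1 - c := by linarith
    have hP : 0 ≤ P := (div_pos hRB h1).le.trans hPc.le
    obtain ⟨h2, h3, -⟩ := hval hP hRA hv
    -- `P ≤ RB / (1 - v)` with `v ≤ c` would contradict `P > RB / (1 - c)`.
    by_contra! h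
    have : RB / (1 - v) ≤ RB / (1 - c) := by gcongr
    linarith
  · refine Set.eq_empty_of_forall_notMem fun q hq => ?_
    obtain ⟨hP, hRA, hv⟩ := hq
    exact absurd hc1 (hval hP hRA hv).1.ne
  · obtain ⟨V, hV, -⟩ := exists_isGameValue hw hsum hP hRA hRB
    refine ⟨fun h => ⟨V, (hV τ hτ).isSPEPayoffA hw hsum hP fun p hp =>
      exists_isSubgameNash_of_mem_preallocations hw hsum hτ hRA hRB (h.imp_right Or.inl) hp⟩,
      fun v hv => ?_⟩
    rw [(hV τ hτ).eq_of_isSPEPayoffA hw hsum hP hv]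
    exact hex0 hP hRA (hV _ hτ0)
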